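/- For a graph $H$ and a graph $G$ let $\mathcal N(H,G)$ be the number of copies of $H$ in $G$ (subgraphs of $G$ isomorphic to $H$), and for a family $\mathcal F$ of graphs let $\mathrm{ex}(n,H,\mathcal F)$ be the maximum of $\mathcal N(H,G)$ over all $n$-vertex graphs $G$ that contain no member of $\mathcal F$ as a (not necessarily induced) subgraph. Let $K_m$, $P_m$ and $I_m$ denote the complete graph, the path and the edgeless graph on $m$ vertices, $M_k$ the matching consisting of $k$ independent edges, $\cup$ disjoint union, $aG$ the disjoint union of $a$ copies of $G$, and $\vee$ the join. **Theorem.** Let $r,p\ge 1$ and $s,a,b\ge 0$ be integers with $s-p+1=a(p-1)+b$ and $0\le b\le p-2$ (so $p\ge 2$), and assume that $r\le p$ or $r\ge 2p$. For $n\ge p+a(2p-1)+2b$ define the $n$-vertex graphs $$G_1=(K_{p-1}\vee I_{n-p+1-a(2p-1)})\cup aK_{2p-1},$$ $$G_2=(K_{p-1}\vee I_{n-p+1-a(2p-1)-(2b+1)})\cup aK_{2p-1}\cup K_{2b+1}.$$ Then there is $n_0=n_0(r,p,s)$ such that for all $n\ge n_0$, $$\mathrm{ex}(n,K_r,\{P_{2p},M_{s+1}\})=\max\{\mathcal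 N(K_r,G_1),\mathcal N(K_r,G_2)\}.$$ -/

import Mathlib

namespace GenTuran

open SimpleGraph

/-- The join `G ∨ H`: the disjoint union of `G` and `H` together with all edges between them. -/
def join {V W : Type} (G : SimpleGraph V) (H : SimpleGraph W) : SimpleGraph (V ⊕ W) where
  Adj
    | .inl v, .inl v' => G.Adj v v'
    | .inr w, .inr w' => H.Adj w w'
    | .inl _, .inr _ => True
    | .inr _, .inl _ => True
  symm := ⟨by
    rintro (v | w) (v' | w') h
    · exact G.adj_symm h
    · trivial
    · trivial
    · exact H.adj_symm h⟩
  loopless := ⟨by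
    rintro (v | w) h
    · exact G.loopless.irrefl v h
    · exact H.loopless.irrefl w h⟩

/-- `k G`: the disjoint union of `k` copies of `G`. -/
def copies (k : ℕ) {V : Type} (G : SimpleGraph V) : SimpleGraph (Fin k × V) where
  Adj x y := x.1 = y.1 ∧ G.Adj x.2 y.2
  symm := ⟨fun _ _ h => ⟨h.1.symm, G.adj_symm h.2⟩⟩
  loopless := ⟨fun x h => G.loopless.irrefl x.2 h.2⟩

/-- The complete graph `K_m`. -/
abbrev K (m : ℕ) : SimpleGraph (Fin m) := ⊤

/-- The graph `I_m` with `m` vertices and no edges. -/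
abbrev I (m : ℕ) : SimpleGraph (Fin m) := ⊥

/-- The path `P_m` on `m` vertices. -/
abbrev P (m : ℕ) : SimpleGraph (Fin m) := pathGraph m

/-- The matching `M_k` consisting of `k` independent edges. -/
abbrev M (k : ℕ) : SimpleGraph (Fin k × Fin 2) := copies k (K 2)

/-- `N(H, G)`: the number of copies of `H` in `G`, that is, of (not necessarily induced) subgraphs
of `G` that are isomorphic to `H`. -/
noncomputable def N {W V : Type} [Fintype V] (H : SimpleGraph W) (G : SimpleGraph V) : ℕ :=
  G.copyCount H

/-- `G` contains no copy (as a not necessarily induced subgraph) of any member of `𝓕`. -/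
def FamilyFree (𝓕 : Set (Σ W : Type, SimpleGraph W)) {V : Type} (G : SimpleGraph V) : Prop :=
  ∀ F ∈ 𝓕, F.2.Free G

open Classical in
/-- The generalized Turán number `ex(n, H, 𝓕)`: the maximum of `N(H, G)` over all `𝓕`-free graphs
`G` on `n` vertices. -/
noncomputable def ex (n : ℕ) {W : Type} (H : SimpleGraph W)
    (𝓕 : Set (Σ W : Type, SimpleGraph W)) : ℕ :=
  (Finset.univ.filter fun G : SimpleGraph (Fin n) => FamilyFree 𝓕 G).sup fun G => N H G

/-- `G₁ = (K_{p-1} ∨ I_{n-p+1-a(2p-1)}) ∪ a K_{2p-1}`; it has `n` vertices as soon as `1 ≤ p` and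
`p - 1 + a(2p-1) ≤ n`. -/
def G₁ (n p a : ℕ) :
    SimpleGraph ((Fin (p - 1) ⊕ Fin (n - (p - 1) - a * (2 * p - 1))) ⊕ (Fin a × Fin (2 * p - 1))) :=
  join (K (p - 1)) (I (n - (p - 1) - a * (2 * p - 1))) ⊕g copies a (K (2 * p - 1))

/-- `G₂ = (K_{p-1} ∨ I_{n-p+1-a(2p-1)-(2b+1)}) ∪ a K_{2p-1} ∪ K_{2b+1}`; it has `n` vertices as soon
as `1 ≤ p` and `p - 1 + a(2p-1) + 2b + 1 ≤ n`. -/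
def G₂ (n p a b : ℕ) :
    SimpleGraph (((Fin (p - 1) ⊕ Fin (n - (p - 1) - a * (2 * p - 1) - (2 * b + 1))) ⊕
      (Fin a × Fin (2 * p - 1))) ⊕ Fin (2 * b + 1)) :=
  (join (K (p - 1)) (I (n - (p - 1) - a * (2 * p - 1) - (2 * b + 1))) ⊕g
    copies a (K (2 * p - 1))) ⊕g K (2 * b + 1)

end GenTuran

/-!
Write `p = q + 1`. A `P_{2p}`-free graph in which all degrees exceed `q` contains a path on
`k ≤ 2q + 1` vertices that is not joined to the rest of the graph: the degrees at the two ends of a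
longest path force it to close up to a cycle, and any edge leaving that cycle would give a longer
path. Removing such paths and the vertices of degree at most `q` one after the other bounds the
number of copies of `K_{r+1}` by `q.choose r` per vertex, plus `k.choose (r + 1) - (q.choose r) k`
for each removed path. As a path on `k` vertices uses up `⌊k/2⌋` edges of a matching, and this gain
is convex in `k`, at most `t` matching edges are best spent on as many copies of `K_{2q+1}` as
possible and one smaller complete graph, or on nothing in place of the latter.

An `M_{s+1}`-free graph has a vertex cover `U` of at most `2s` vertices. If only boundedly many
vertices outside `U` have degree at least `q`, there are at most `(q.choose r) (n - q)` copies of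
`K_{r+1}` for large `n`. Otherwise a set `S` of `q` vertices has many common neighbours. A path on
two vertices outside `S`, followed by a vertex of `S`, extends to a path on `2q + 2` vertices, so a
neighbour of `S` outside `S` has all its neighbours in `S`. The remaining vertices span a graph
without `M_{s-q+1}`, to which the first bound applies.
-/

namespace GenTuran

open SimpleGraph Finset

section Cliques

variable {V W : Type*} {G : SimpleGraph V} {A B s : Finset V} {r d : ℕ} {v : V}

open Classical in
/-- The set of `r`-cliques of `G` all of whose vertices lie in `A`. -/
noncomputable def cliquesIn (G : SimpleGraph V) (r : ℕ) (A : Finset V) : Finset (Finset V) :=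
  {s ∈ A.powerset | G.IsNClique r s}

theorem mem_cliquesIn : s ∈ cliquesIn G r A ↔ s ⊆ A ∧ G.IsNClique r s := by
  simp [cliquesIn]

theorem cliquesIn_subset_powersetCard (G : SimpleGraph V) (r : ℕ) (A : Finset V) :
    cliquesIn G r A ⊆ powersetCard r A := fun _ hs ↦
  mem_powersetCard.2 ⟨(mem_cliquesIn.1 hs).1, (mem_cliquesIn.1 hs).2.card_eq⟩

theorem card_cliquesIn_le_choose (G : SimpleGraph V) (r : ℕ) (A : Finset V) :
    #(cliquesIn G r A) ≤ (#A).choose r :=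
  card_powersetCard r A ▸ card_le_card (cliquesIn_subset_powersetCard G r A)

theorem card_cliquesIn_of_isClique (r : ℕ) (hA : G.IsClique (A : Set V)) :
    #(cliquesIn G r A) = (#A).choose r := by
  rw [← card_powersetCard]
  refine congrArg card (Subset.antisymm (cliquesIn_subset_powersetCard G r A) fun s hs ↦ ?_)
  rw [mem_powersetCard] at hs
  exact mem_cliquesIn.2 ⟨hs.1, hA.subset (mod_cast hs.1), hs.2⟩

theorem card_cliquesIn_one (G : SimpleGraph V) (A : Finset V) : #(cliquesIn G 1 A) = #A := by
  rw [← Nat.choose_one_right #A, ← card_powersetCard]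
  refine congrArg card (Subset.antisymm (cliquesIn_subset_powersetCard G 1 A) fun s hs ↦ ?_)
  obtain ⟨hsA, v, rfl⟩ := mem_powersetCard.1 hs |>.imp_right card_eq_one.1
  exact mem_cliquesIn.2 ⟨hsA, by simp⟩

theorem card_cliquesIn_insert [DecidableEq V] (G : SimpleGraph V) [DecidableRel G.Adj] (r : ℕ)
    (hv : v ∉ A) : #(cliquesIn G (r + 1) (insert v A)) =
      #(cliquesIn G (r + 1) A) + #(cliquesIn G r {w ∈ A | G.Adj v w}) := by
  have hwithout : {s ∈ cliquesIn G (r + 1) (insert v A) | v ∉ s} = cliquesIn G (r + 1) A := by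
    ext s
    simp only [mem_filter, mem_cliquesIn]
    exact ⟨fun h ↦ ⟨(subset_insert_iff_of_notMem h.2).1 h.1.1, h.1.2⟩,
      fun h ↦ ⟨⟨h.1.trans (subset_insert _ _), h.2⟩, fun hs ↦ hv (h.1 hs)⟩⟩
  have hwith : #{s ∈ cliquesIn G (r + 1) (insert v A) | v ∈ s} =
      #(cliquesIn G r {w ∈ A | G.Adj v w}) := by
    refine card_nbij' (·.erase v) (insert v) (fun s hs ↦ ?_) (fun s hs ↦ ?_) (fun s hs ↦ ?_)
      fun s hs ↦ ?_
    · simp only [coe_filter, Set.mem_ofPred_eq, mem_cliquesIn] at hs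
      refine mem_cliquesIn.2 ⟨fun w hw ↦ ?_, hs.1.2.erase_of_mem hs.2⟩
      obtain ⟨hwv, hws⟩ := mem_erase.1 hw
      exact mem_filter.2 ⟨mem_of_mem_insert_of_ne (hs.1.1 hws) hwv,
        hs.1.2.isClique hs.2 hws hwv.symm⟩
    · obtain ⟨hsA, hs⟩ := mem_cliquesIn.1 hs
      exact mem_filter.2 ⟨mem_cliquesIn.2 ⟨insert_subset_insert _ (hsA.trans (filter_subset _ _)),
        hs.insert fun w hw ↦ (mem_filter.1 (hsA hw)).2⟩, mem_insert_self _ _⟩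
    · exact insert_erase (mem_filter.1 hs).2
    · exact erase_insert fun hvs ↦ hv (mem_filter.1 ((mem_cliquesIn.1 hs).1 hvs)).1
  rw [← card_filter_add_card_filter_not (s := cliquesIn G (r + 1) (insert v A)) (v ∉ ·), hwithout]
  simpa using hwith

theorem card_cliquesIn_le_of_degree_le [DecidableEq V] [DecidableRel G.Adj] (hAB : A ⊆ B)
    (hd : ∀ v ∈ B \ A, #{w ∈ B | G.Adj v w} ≤ d) :
    #(cliquesIn G (r + 1) B) ≤ #(cliquesIn G (r + 1) A) + d.choose r * #(B \ A) := by
  have hX : ∀ X ⊆ B \ A,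
      #(cliquesIn G (r + 1) (X ∪ A)) ≤ #(cliquesIn G (r + 1) A) + d.choose r * #X := by
    intro X
    induction X using Finset.induction_on with
    | empty => simp
    | insert v X hv ih =>
      intro hX
      obtain ⟨hvB, hX⟩ := insert_subset_iff.1 hX
      have hvXA : v ∉ X ∪ A := by simp [hv, (mem_sdiff.1 hvB).2]
      have hnbr : {w ∈ X ∪ A | G.Adj v w} ⊆ {w ∈ B | G.Adj v w} :=
        filter_subset_filter _ (union_subset (hX.trans sdiff_subset) hAB)
      have hnew := (card_cliquesIn_le_choose G r {w ∈ X ∪ A | G.Adj v w}).trans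
        (Nat.choose_le_choose r ((card_le_card hnbr).trans (hd v hvB)))
      rw [insert_union, card_cliquesIn_insert G r hvXA, card_insert_of_notMem hv]
      linarith [ih hX]
  simpa [sdiff_union_of_subset hAB] using hX (B \ A) Subset.rfl

theorem card_cliquesIn_union [DecidableEq V] (r : ℕ) (hAB : Disjoint A B)
    (hG : ∀ v ∈ A, ∀ w ∈ B, ¬G.Adj v w) :
    #(cliquesIn G (r + 1) (A ∪ B)) = #(cliquesIn G (r + 1) A) + #(cliquesIn G (r + 1) B) := by
  rw [← card_union_of_disjoint]
  · congr 1
    ext s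
    simp only [mem_union, mem_cliquesIn, ← or_and_right, and_congr_left_iff]
    refine fun hs ↦ ⟨fun hsAB ↦ ?_, fun h ↦ h.elim (·.trans subset_union_left)
      (·.trans subset_union_right)⟩
    by_contra! hsplit
    obtain ⟨x, hx, hxA⟩ := not_subset.1 hsplit.1
    obtain ⟨y, hy, hyB⟩ := not_subset.1 hsplit.2
    have hxB := (mem_union.1 (hsAB hx)).resolve_left hxA
    have hyA := (mem_union.1 (hsAB hy)).resolve_right hyB
    exact hG y hyA x hxB (hs.isClique hy hx fun hyx ↦ hxA (hyx ▸ hyA))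
  · refine disjoint_left.2 fun s hsA hsB ↦ ?_
    rw [mem_cliquesIn] at hsA hsB
    have hs : s = ∅ := disjoint_self.1 (hAB.mono hsA.1 hsB.1)
    simpa [hs] using hsA.2.card_eq

theorem card_cliquesIn_map {H : SimpleGraph W} (e : G ↪g H) (r : ℕ) (A : Finset V) :
    #(cliquesIn H r (A.map e.toEmbedding)) = #(cliquesIn G r A) := by
  symm
  refine card_nbij (·.map e.toEmbedding) (fun s hs ↦ ?_) (Finset.map_injective _).injOn
    fun t ht ↦ ?_
  · rw [mem_coe, mem_cliquesIn] at hs ⊢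
    refine ⟨map_subset_map.2 hs.1, ?_, by simpa using hs.2.card_eq⟩
    rintro _ hx _ hy hxy
    simp only [coe_map, Set.mem_image] at hx hy
    obtain ⟨x, hx, rfl⟩ := hx
    obtain ⟨y, hy, rfl⟩ := hy
    exact e.map_adj_iff.2 (hs.2.isClique hx hy fun h ↦ hxy (congrArg _ h))
  · obtain ⟨htA, ht⟩ := mem_cliquesIn.1 ht
    obtain ⟨s, hsA, rfl⟩ := subset_map_iff.1 htA
    refine ⟨s, mem_cliquesIn.2 ⟨hsA, fun x hx y hy hxy ↦ ?_, by simpa using ht.card_eq⟩, rfl⟩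
    exact e.map_adj_iff.1 (ht.isClique (by simpa using hx) (by simpa using hy)
      fun h ↦ hxy (e.injective h))

end Cliques

section Counting

theorem eq_top_of_iso {V W : Type*} {H : SimpleGraph W} (e : (⊤ : SimpleGraph V) ≃g H) :
    H = ⊤ := by
  ext v w
  rw [← e.symm.map_adj_iff, top_adj, top_adj, e.symm.injective.ne_iff]

theorem eq_induce_top_of_coe_eq_top {V : Type*} {G : SimpleGraph V} {G' : G.Subgraph}
    (h : G'.coe = ⊤) : G' = (⊤ : G.Subgraph).induce G'.verts := by
  refine Subgraph.ext rfl (funext₂ fun v w ↦ propext ⟨fun hvw ↦ ?_, fun ⟨hv, hw, hvw⟩ ↦ ?_⟩)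
  · exact ⟨G'.edge_vert hvw, G'.edge_vert hvw.symm, hvw.adj_sub⟩
  · have hvw' : G'.coe.Adj ⟨v, hv⟩ ⟨w, hw⟩ := by simpa [h] using hvw.ne
    exact hvw'

variable {V W : Type} [Fintype V] [Fintype W]

theorem N_K_eq (G : SimpleGraph V) (r : ℕ) : N (K r) G = #(cliquesIn G r univ) := by
  classical
  refine card_nbij' (fun G' ↦ G'.verts.toFinset) (fun s ↦ (⊤ : G.Subgraph).induce s)
    (fun G' hG' ↦ ?_) (fun s hs ↦ ?_) (fun G' hG' ↦ ?_) fun s _ ↦ by simp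
  · obtain ⟨e⟩ := (mem_filter.1 hG').2
    refine mem_cliquesIn.2 ⟨subset_univ _, ?_, ?_⟩
    · rw [Set.coe_toFinset, ← induce_eq_top, eq_top_iff, ← eq_top_of_iso e]
      exact fun v w ↦ Subgraph.Adj.adj_sub
    · rw [Set.toFinset_card, ← Fintype.card_congr e.toEquiv, Fintype.card_fin]
  · obtain ⟨-, hs, hcard⟩ := mem_cliquesIn.1 hs
    refine mem_filter.2 ⟨mem_univ _, ?_⟩
    rw [← induce_eq_coe_induce_top, induce_eq_top.2 hs]
    exact ⟨Iso.completeGraph (Fintype.equivFinOfCardEq (by simpa using hcard)).symm⟩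
  · obtain ⟨e⟩ := (mem_filter.1 hG').2
    simpa using (eq_induce_top_of_coe_eq_top (eq_top_of_iso e)).symm

theorem N_K_congr {G : SimpleGraph V} {H : SimpleGraph W} (e : G ≃g H) (r : ℕ) :
    N (K r) G = N (K r) H := by
  rw [N_K_eq, N_K_eq, ← card_cliquesIn_map e.toEmbedding]
  exact congrArg (fun A ↦ #(cliquesIn H r A)) (map_univ_equiv e.toEquiv)

theorem N_K_K (r m : ℕ) : N (K r) (K m) = m.choose r := by
  rw [N_K_eq, card_cliquesIn_of_isClique r (by simp), card_fin]

theorem N_K_sum (G : SimpleGraph V) (H : SimpleGraph W) (r : ℕ) :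
    N (K (r + 1)) (G ⊕g H) = N (K (r + 1)) G + N (K (r + 1)) H := by
  classical
  have hdisj : Disjoint (univ.map (Embedding.sumInl : G ↪g G ⊕g H).toEmbedding)
      (univ.map (Embedding.sumInr : H ↪g G ⊕g H).toEmbedding) := by
    simp [Finset.disjoint_left]
  rw [N_K_eq, N_K_eq, N_K_eq, ← card_cliquesIn_map (Embedding.sumInl : G ↪g G ⊕g H),
    ← card_cliquesIn_map (Embedding.sumInr : H ↪g G ⊕g H),
    ← card_cliquesIn_union r hdisj (by simp)]
  congr 1
  ext s
  simp [mem_cliquesIn, subset_iff]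

/-- The embedding of `G` into a join as its first part. -/
def joinInl {V W : Type} (G : SimpleGraph V) (H : SimpleGraph W) : G ↪g join G H :=
  ⟨.inl, Iff.rfl⟩

theorem N_K_join_I (G : SimpleGraph V) (r m : ℕ) :
    N (K (r + 1)) (join G (I m)) = N (K (r + 1)) G + m * N (K r) G := by
  classical
  have hY : ∀ Y : Finset (Fin m), #(cliquesIn (join G (I m)) (r + 1) (univ.disjSum Y)) =
      N (K (r + 1)) G + #Y * N (K r) G := by
    intro Y
    rw [N_K_eq, N_K_eq, ← card_cliquesIn_map (joinInl G (I m)) (r + 1),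
      ← card_cliquesIn_map (joinInl G (I m)) r]
    induction Y using Finset.induction_on with
    | empty => simp [joinInl, Function.Embedding.inl]
    | insert y Y hy ih =>
      have hinsert : univ.disjSum (insert y Y) = insert (.inr y) ((univ : Finset V).disjSum Y) := by
        ext (v | w) <;> simp
      have hnbr : {w ∈ (univ : Finset V).disjSum Y | (join G (I m)).Adj (.inr y) w} =
          univ.map (joinInl G (I m)).toEmbedding := by
        ext (v | w) <;> simp [joinInl, join]
      rw [hinsert, card_cliquesIn_insert _ _ (by simpa using hy), ih, hnbr,
        card_insert_of_notMem hy, Nat.succ_mul, add_assoc]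
  simpa [N_K_eq (join G (I m))] using hY univ

/-- The disjoint union of `j` copies and `k` copies of `G` consists of `j + k` copies of `G`. -/
def copiesAddIso {V : Type} (j k : ℕ) (G : SimpleGraph V) :
    copies j G ⊕g copies k G ≃g copies (j + k) G where
  toEquiv := (Equiv.sumProdDistrib _ _ _).symm.trans (finSumFinEquiv.prodCongr (.refl V))
  map_rel_iff' := by
    rintro (⟨i, v⟩ | ⟨i, v⟩) (⟨i', v'⟩ | ⟨i', v'⟩) <;>
      simp [copies, Fin.ext_iff] <;> omega

/-- A single copy of `G` is `G`. -/
def copiesOneIso {V : Type} (G : SimpleGraph V) : copies 1 G ≃g G where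
  toEquiv := Equiv.uniqueProd V (Fin 1)
  map_rel_iff' := by simp [copies, Subsingleton.elim (α := Fin 1) _ 0]

/-- The last of `k + 1` copies of `G` can be split off. -/
def copiesSuccIso {V : Type} (k : ℕ) (G : SimpleGraph V) :
    copies k G ⊕g G ≃g copies (k + 1) G :=
  (Iso.refl.sumCongr (copiesOneIso G).symm).trans (copiesAddIso k 1 G)

theorem N_K_copies (G : SimpleGraph V) (r k : ℕ) :
    N (K (r + 1)) (copies k G) = k * N (K (r + 1)) G := by
  induction k with
  | zero => simp [N_K_eq, cliquesIn]
  | succ k ih => rw [← N_K_congr (copiesSuccIso k G), N_K_sum, ih, Nat.succ_mul]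

theorem N_K_G₁ (n r q a : ℕ) :
    N (K (r + 1)) (G₁ n (q + 1) a) =
      q.choose (r + 1) + (n - q - a * (2 * q + 1)) * q.choose r +
        a * (2 * q + 1).choose (r + 1) := by
  simp only [G₁, N_K_sum, N_K_join_I, N_K_copies, N_K_K, Nat.add_sub_cancel]
  rfl

theorem N_K_G₂ (n r q a b : ℕ) :
    N (K (r + 1)) (G₂ n (q + 1) a b) =
      q.choose (r + 1) + (n - q - a * (2 * q + 1) - (2 * b + 1)) * q.choose r +
        a * (2 * q + 1).choose (r + 1) + (2 * b + 1).choose (r + 1) := by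
  simp only [G₂, N_K_sum, N_K_join_I, N_K_copies, N_K_K, Nat.add_sub_cancel]
  rfl

end Counting

section Matchings

variable {V W W₁ W₂ : Type*} {G : SimpleGraph V} {A B : Set V} {j k m s : ℕ}

theorem sum_isContained_induce_union {H₁ : SimpleGraph W₁} {H₂ : SimpleGraph W₂}
    (hAB : Disjoint A B) (h₁ : H₁ ⊑ G.induce A) (h₂ : H₂ ⊑ G.induce B) :
    H₁ ⊕g H₂ ⊑ G.induce (A ∪ B) := by
  obtain ⟨f₁⟩ := h₁
  obtain ⟨f₂⟩ := h₂
  refine ⟨⟨⟨Sum.elim (fun v ↦ ⟨f₁ v, .inl (f₁ v).2⟩) fun w ↦ ⟨f₂ w, .inr (f₂ w).2⟩, ?_⟩, ?_⟩⟩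
  · rintro (v | v) (w | w) h
    exacts [f₁.toHom.map_adj h, by simp at h, by simp at h, f₂.toHom.map_adj h]
  · refine Function.Injective.sumElim (fun v w h ↦ ?_) (fun v w h ↦ ?_) fun v w h ↦ ?_
    · exact f₁.injective (Subtype.ext (congrArg Subtype.val h :))
    · exact f₂.injective (Subtype.ext (congrArg Subtype.val h :))
    · exact hAB.ne_of_mem (f₁ v).2 (f₂ w).2 (congrArg Subtype.val h)

theorem isContained_induce_range {H : SimpleGraph W} (f : Copy H G) :
    H ⊑ G.induce (Set.range f) :=
  ⟨⟨⟨fun v ↦ ⟨f v, v, rfl⟩, f.toHom.map_adj⟩, fun _ _ h ↦ f.injective (congrArg Subtype.val h)⟩⟩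

theorem M_isContained_M (h : j ≤ k) : M j ⊑ M k := by
  obtain ⟨d, rfl⟩ := Nat.exists_eq_add_of_le h
  exact Embedding.sumInl.isContained.trans (copiesAddIso j d (K 2)).isContained

theorem M_add_isContained_induce_union (hAB : Disjoint A B) (hA : M j ⊑ G.induce A)
    (hB : M k ⊑ G.induce B) : M (j + k) ⊑ G.induce (A ∪ B) :=
  (copiesAddIso j k (K 2)).symm.isContained.trans (sum_isContained_induce_union hAB hA hB)

theorem M_zero_isContained (G : SimpleGraph V) : M 0 ⊑ G := .of_isEmpty

theorem M_one_isContained_induce_pair {v w : V} (h : G.Adj v w) : M 1 ⊑ G.induce {v, w} := by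
  refine (copiesOneIso (K 2)).isContained.trans ⟨⟨⟨![⟨v, by simp⟩, ⟨w, by simp⟩], ?_⟩, ?_⟩⟩
  · intro i j
    fin_cases i <;> fin_cases j <;> simp [h, h.symm]
  · intro i j
    fin_cases i <;> fin_cases j <;> simp [h.ne, h.ne']

theorem M_isContained_P (h : 2 * k ≤ m) : M k ⊑ P m := by
  refine ⟨⟨⟨fun x ↦ ⟨2 * x.1 + x.2, by omega⟩, ?_⟩, fun x y hxy ↦ ?_⟩⟩
  · rintro ⟨i, u⟩ ⟨j, v⟩ ⟨hij : i = j, huv⟩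
    have huv' : (u : ℕ) ≠ v := Fin.val_ne_iff.2 huv
    simp only [pathGraph_adj]
    omega
  · simp only [RelHom.coeFn_mk, Fin.mk.injEq] at hxy
    ext <;> omega

theorem two_mul_le_of_M_isContained_K (h : M k ⊑ K m) : 2 * k ≤ m := by
  obtain ⟨f⟩ := isContained_top_iff.1 h
  simpa [mul_comm] using Fintype.card_le_of_embedding f

theorem le_card_of_M_isContained_of_isVertexCover {U : Finset V}
    (hU : G.IsVertexCover (U : Set V)) (h : M k ⊑ G) : k ≤ #U := by
  obtain ⟨f⟩ := h
  have hend : ∀ i : Fin k, ∃ e : Fin 2, f (i, e) ∈ U := fun i ↦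
    (hU (f.toHom.map_adj (v := (i, 0)) (w := (i, 1)) ⟨rfl, Fin.zero_ne_one⟩)).elim (⟨0, ·⟩) (⟨1, ·⟩)
  choose e he using hend
  have hinj : Function.Injective fun i ↦ (⟨f (i, e i), he i⟩ : U) := fun i j hij ↦
    congrArg Prod.fst (f.injective (congrArg Subtype.val hij))
  simpa using Fintype.card_le_of_injective _ hinj

theorem isVertexCover_range_of_M_free (f : Copy (M s) G) (h : (M (s + 1)).Free G) :
    G.IsVertexCover (Set.range f) := by
  intro v w hvw
  by_contra! hmiss
  have hdisj : Disjoint (Set.range f) {v, w} := by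
    simpa [Set.disjoint_insert_right] using hmiss
  exact h ((M_add_isContained_induce_union hdisj (isContained_induce_range f)
    (M_one_isContained_induce_pair hvw)).trans (Embedding.induce _).isContained)

theorem exists_isVertexCover_of_M_free (h : (M (s + 1)).Free G) :
    ∃ U : Finset V, #U ≤ 2 * s ∧ G.IsVertexCover (U : Set V) := by
  induction s with
  | zero =>
    obtain ⟨f⟩ := M_zero_isContained G
    refine ⟨∅, by simp, (isVertexCover_range_of_M_free f h).subset ?_⟩
    exact (Set.range_eq_empty f ▸ Set.empty_subset _)
  | succ s ih =>
    obtain hfree | ⟨⟨f⟩⟩ := em' (M (s + 1) ⊑ G)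
    · obtain ⟨U, hU, hcover⟩ := ih hfree
      exact ⟨U, by omega, hcover⟩
    · refine ⟨univ.map f.toEmbedding, by simp [mul_comm], ?_⟩
      rw [coe_map, coe_univ, Set.image_univ]
      exact isVertexCover_range_of_M_free f h

end Matchings

section Paths

variable {V : Type*} {G : SimpleGraph V} {A : Finset V} {l c : List V} {v w : V} {q : ℕ}

/-- `l` lists, in order, the vertices of a path of `G` inside `A`. Paths are encoded as lists rather
than as walks because the arguments below cut them up, reverse and rotate them. -/
structure IsPathIn (G : SimpleGraph V) (A : Finset V) (l : List V) : Prop where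
  isChain : l.IsChain G.Adj
  nodup : l.Nodup
  mem : ∀ v ∈ l, v ∈ A

theorem IsPathIn.reverse (h : IsPathIn G A l) : IsPathIn G A l.reverse where
  isChain := List.isChain_reverse.2 (h.isChain.imp fun _ _ ↦ Adj.symm)
  nodup := List.nodup_reverse.2 h.nodup
  mem v hv := h.mem v (List.mem_reverse.1 hv)

theorem IsPathIn.cons (h : IsPathIn G A (v :: l)) (hwA : w ∈ A) (hw : w ∉ v :: l)
    (hwv : G.Adj w v) : IsPathIn G A (w :: v :: l) where
  isChain := h.isChain.cons_cons hwv
  nodup := h.nodup.cons hw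
  mem := List.forall_mem_cons.2 ⟨hwA, h.mem⟩

theorem IsPathIn.length_le_card (h : IsPathIn G A l) : l.length ≤ #A := by
  classical
  rw [← List.toFinset_card_of_nodup h.nodup]
  exact card_le_card fun v hv ↦ h.mem v (List.mem_toFinset.1 hv)

theorem P_isContained_P {m n : ℕ} (h : m ≤ n) : P m ⊑ P n :=
  ⟨⟨⟨Fin.castLE h, fun hij ↦ by simpa [pathGraph_adj] using hij⟩, Fin.castLE_injective h⟩⟩

theorem P_isContained_induce (hchain : l.IsChain G.Adj) (hnodup : l.Nodup) :
    P l.length ⊑ G.induce {v | v ∈ l} := by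
  rw [List.isChain_iff_getElem] at hchain
  refine ⟨⟨⟨fun i ↦ ⟨l[i], l.getElem_mem i.2⟩, fun {i j} hij ↦ ?_⟩, fun i j hij ↦ ?_⟩⟩
  · obtain ⟨i, hi⟩ := i
    obtain ⟨j, hj⟩ := j
    obtain rfl | rfl := pathGraph_adj.1 hij
    exacts [hchain i hj, (hchain j hi).symm]
  · exact Fin.ext ((hnodup.getElem_inj_iff).1 (congrArg Subtype.val hij))

theorem exists_longest_isPathIn (G : SimpleGraph V) (hA : A.Nonempty) :
    ∃ l ≠ [], IsPathIn G A l ∧ ∀ l', IsPathIn G A l' → l'.length ≤ l.length := by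
  obtain ⟨v, hv⟩ := hA
  have hsingle : IsPathIn G A [v] := ⟨by simp, by simp, by simpa using hv⟩
  let lengths := {k | ∃ l, IsPathIn G A l ∧ l.length = k}
  have hbdd : BddAbove lengths := ⟨#A, by rintro _ ⟨l, hl, rfl⟩; exact hl.length_le_card⟩
  have hmem : lengths.Nonempty := ⟨1, [v], hsingle, rfl⟩
  obtain ⟨l, hl, hlen⟩ := Nat.sSup_mem hmem hbdd
  have hmax : ∀ l', IsPathIn G A l' → l'.length ≤ l.length := fun l' hl' ↦
    hlen.symm ▸ le_csSup hbdd ⟨l', hl', rfl⟩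
  exact ⟨l, List.ne_nil_of_length_pos (hmax [v] hsingle), hl, hmax⟩

theorem card_neighbors_head_le [DecidableRel G.Adj] (h : IsPathIn G A l) (hne : l ≠ [])
    (hmax : ∀ l', IsPathIn G A l' → l'.length ≤ l.length) :
    #{w ∈ A | G.Adj (l.head hne) w} ≤ l.tail.countP (G.Adj (l.head hne) ·) := by
  classical
  obtain ⟨v, l, rfl⟩ := List.exists_cons_of_ne_nil hne
  rw [List.countP_eq_length_filter]
  refine (card_le_card fun w hw ↦ ?_).trans (List.toFinset_card_le _)
  obtain ⟨hwA, hvw : G.Adj v w⟩ := mem_filter.1 hw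
  have hwl : w ∈ v :: l := by
    by_contra hwl
    simpa using hmax _ (h.cons hwA hwl hvw.symm)
  simpa [hvw] using (List.mem_cons.1 hwl).resolve_left hvw.ne'

theorem card_neighbors_getLast_le [DecidableRel G.Adj] (h : IsPathIn G A l) (hne : l ≠ [])
    (hmax : ∀ l', IsPathIn G A l' → l'.length ≤ l.length) :
    #{w ∈ A | G.Adj (l.getLast hne) w} ≤ l.dropLast.countP (G.Adj (l.getLast hne) ·) := by
  have hrev := card_neighbors_head_le h.reverse (List.reverse_ne_nil_iff.2 hne)
    (by simpa using hmax)
  rwa [List.head_reverse, List.tail_reverse, List.countP_reverse] at hrev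

theorem exists_split_of_length_le_countP_add {α : Type*} {φ ψ : α → Bool} {l : List α}
    (hne : l ≠ []) (hlen : l.length ≤ l.tail.countP φ + l.dropLast.countP ψ) :
    ∃ s a b t, l = s ++ a :: b :: t ∧ ψ a ∧ φ b := by
  induction l with
  | nil => exact absurd rfl hne
  | cons a l ih =>
    obtain _ | ⟨b, t⟩ := l
    · simp at hlen
    by_cases hab : ψ a ∧ φ b
    · exact ⟨[], a, b, t, rfl, hab⟩
    · obtain ⟨s, a', b', t', hsplit, hab'⟩ := ih (by simp) <| by
        simp only [List.tail_cons, List.countP_cons, List.dropLast_cons_cons,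
          List.length_cons] at hlen ⊢
        split_ifs at hlen <;> first | omega | tauto
      exact ⟨a :: s, a', b', t', by simp [hsplit], hab'⟩

/-- The rotation of Pósa and Dirac: if the last vertex of a path is adjacent to a vertex `a` and the
first one to the successor `b` of `a`, the path closes up to a cycle. -/
theorem exists_cycle_of_crossing {s t : List V} {a b : V} (hne : s ++ a :: b :: t ≠ [])
    (h : (s ++ a :: b :: t).IsChain G.Adj)
    (hlast : G.Adj ((s ++ a :: b :: t).getLast hne) a)
    (hhead : G.Adj ((s ++ a :: b :: t).head hne) b) :
    ∃ c : List V, c.Perm (s ++ a :: b :: t) ∧ Cycle.Chain G.Adj c := by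
  obtain ⟨hs, -, ht⟩ := List.isChain_append_cons_cons.1 h
  have ht' : (b :: t).reverse.IsChain G.Adj :=
    List.isChain_reverse.2 (ht.imp fun _ _ ↦ Adj.symm)
  refine ⟨b :: (s ++ [a] ++ t.reverse), ?_, ?_⟩
  · exact ((t.reverse_perm.append_left (s ++ [a])).cons b).trans
      (by simpa using (List.perm_middle (l₁ := s ++ [a])).symm)
  · have hsplit : b :: (s ++ [a] ++ t.reverse ++ [b]) = [b] ++ (s ++ [a]) ++ (b :: t).reverse := by
      simp
    rw [Cycle.chain_coe_cons, hsplit, List.isChain_append, List.isChain_append]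
    refine ⟨⟨List.isChain_singleton b, hs, ?_⟩, ht', ?_⟩
    · cases s <;> simpa using hhead.symm
    · rw [← List.append_assoc, List.getLast?_concat, List.head?_reverse,
        List.getLast?_eq_some_getLast (List.cons_ne_nil b t)]
      simpa using hlast.symm

theorem not_adj_of_cycle (hcycle : Cycle.Chain G.Adj c) (hnodup : c.Nodup)
    (hcA : ∀ x ∈ c, x ∈ A) (hmax : ∀ l', IsPathIn G A l' → l'.length ≤ c.length) (hv : v ∈ c)
    (hwA : w ∈ A) (hw : w ∉ c) : ¬G.Adj v w := by
  intro hvw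
  obtain ⟨s, t, rfl⟩ := List.append_of_mem hv
  have hrot : s ++ v :: t ~r v :: t ++ s := List.isRotated_append
  have hpath : IsPathIn G A (v :: (t ++ s)) := by
    refine ⟨?_, hrot.nodup_iff.1 hnodup, fun x hx ↦ hcA x (hrot.mem_iff.2 hx)⟩
    rw [Cycle.coe_eq_coe.2 hrot, List.cons_append, Cycle.chain_coe_cons,
      ← List.cons_append] at hcycle
    exact (List.isChain_append.1 hcycle).1
  have hlong := hmax _ (hpath.cons hwA (fun h ↦ hw (hrot.mem_iff.2 h)) hvw.symm)
  simp at hlong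
  omega

theorem exists_isolated_path [DecidableEq V] [DecidableRel G.Adj] (hA : A.Nonempty)
    (hdeg : ∀ v ∈ A, q + 1 ≤ #{w ∈ A | G.Adj v w}) (hP : (P (2 * (q + 1))).Free G) :
    ∃ X ⊆ A, X.Nonempty ∧ #X < 2 * (q + 1) ∧ P #X ⊑ G.induce X ∧
      ∀ v ∈ X, ∀ w ∈ A \ X, ¬G.Adj v w := by
  obtain ⟨l, hne, hl, hmax⟩ := exists_longest_isPathIn G hA
  have hlen : l.length < 2 * (q + 1) := by
    by_contra! hlen
    exact hP ((P_isContained_P hlen).trans ((P_isContained_induce hl.isChain hl.nodup).trans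
      (Embedding.induce _).isContained))
  have hhead := (hdeg _ (hl.mem _ (l.head_mem hne))).trans (card_neighbors_head_le hl hne hmax)
  have hlast := (hdeg _ (hl.mem _ (l.getLast_mem hne))).trans
    (card_neighbors_getLast_le hl hne hmax)
  obtain ⟨s, a, b, t, rfl, ha, hb⟩ :=
    exists_split_of_length_le_countP_add (φ := (G.Adj (l.head hne) ·))
      (ψ := (G.Adj (l.getLast hne) ·)) hne (by omega)
  obtain ⟨c, hperm, hcycle⟩ :=
    exists_cycle_of_crossing hne hl.isChain (of_decide_eq_true ha) (of_decide_eq_true hb)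
  generalize s ++ a :: b :: t = l at hne hl hmax hlen hperm
  have hcard : #l.toFinset = l.length := List.toFinset_card_of_nodup hl.nodup
  refine ⟨l.toFinset, fun v hv ↦ hl.mem v (List.mem_toFinset.1 hv), by simpa using hne,
    hcard.trans_lt hlen, ?_, fun v hv w hw ↦ ?_⟩
  · rw [hcard, List.coe_toFinset]
    exact P_isContained_induce hl.isChain hl.nodup
  · rw [List.mem_toFinset, ← hperm.mem_iff] at hv
    rw [mem_sdiff, List.mem_toFinset, ← hperm.mem_iff] at hw
    exact not_adj_of_cycle hcycle (hperm.nodup_iff.2 hl.nodup)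
      (fun x hx ↦ hl.mem x (hperm.mem_iff.1 hx)) (hperm.length_eq ▸ hmax) hv hw.1 hw.2

end Paths

section Convexity

/-- Convexity of a sequence of integers: its second differences are nonnegative. -/
def IsConvexSeq (F : ℕ → ℤ) : Prop := ∀ k, 2 * F (k + 1) ≤ F k + F (k + 2)

variable {F : ℕ → ℤ} {q r : ℕ}

theorem IsConvexSeq.add_le_add (hF : IsConvexSeq F) {i j : ℕ} (hij : i ≤ j) (d : ℕ) :
    F (i + d) + F j ≤ F i + F (j + d) := by
  have hmono : Monotone fun k ↦ F (k + 1) - F k :=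
    monotone_nat_of_le_succ fun k ↦ by linarith [hF k]
  induction d with
  | zero => simp
  | succ d ih =>
    have hstep : F (i + d + 1) - F (i + d) ≤ F (j + d + 1) - F (j + d) :=
      hmono (Nat.add_le_add_right hij d)
    rw [← add_assoc, ← add_assoc]
    linarith

theorem IsConvexSeq.comp_two_mul_add_one (hF : IsConvexSeq F) :
    IsConvexSeq fun k ↦ F (2 * k + 1) := fun k ↦ by
  have h := hF.add_le_add (show 2 * k + 1 ≤ 2 * k + 3 by omega) 2
  simp only [show 2 * (k + 1) + 1 = 2 * k + 3 by ring, show 2 * (k + 2) + 1 = 2 * k + 3 + 2 by ring]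
  linarith

/-- The value `∑ F (parts)` of the partition of `t` into parts of size `q` and one part of size
`t % q`. By convexity it is the largest value of a partition of `t` into parts of size at most
`q`. -/
def splitValue (F : ℕ → ℤ) (q t : ℕ) : ℤ := (t / q : ℕ) * F q + F (t % q)

theorem splitValue_mul_add (F : ℕ → ℤ) (m : ℕ) {u : ℕ} (hu : u < q) :
    splitValue F q (m * q + u) = m * F q + F u := by
  rw [splitValue, mul_comm m, Nat.mul_add_div (by omega), Nat.mul_add_mod, Nat.div_eq_of_lt hu,
    Nat.mod_eq_of_lt hu, add_zero]

theorem splitValue_add_le (hF : IsConvexSeq F) (hF0 : F 0 = 0) (hq : 0 < q) (t : ℕ) {j : ℕ}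
    (hj : j ≤ q) : splitValue F q t + F j ≤ splitValue F q (t + j) := by
  obtain ⟨m, u, hu, rfl⟩ : ∃ m u, u < q ∧ t = m * q + u :=
    ⟨t / q, t % q, Nat.mod_lt _ hq, (Nat.div_add_mod' t q).symm⟩
  rw [splitValue_mul_add F m hu, add_assoc (m * q)]
  obtain hlt | hge := lt_or_ge (u + j) q
  · rw [splitValue_mul_add F m hlt]
    have h := hF.add_le_add u.zero_le j
    rw [zero_add, hF0] at h
    linarith
  · obtain ⟨i, hi⟩ := Nat.exists_eq_add_of_le hge
    rw [hi, show m * q + (q + i) = (m + 1) * q + i by ring,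
      splitValue_mul_add F (m + 1) (by omega)]
    have h := hF.add_le_add (show i ≤ j by omega) (q - j)
    rw [show i + (q - j) = u by omega, Nat.add_sub_cancel' hj] at h
    push_cast
    linarith

/-- What a component `K_k` gains over `k` vertices that each lie in `c` cliques of size `r + 1`,
or `0` if it gains nothing. -/
def cliqueGain (c r k : ℕ) : ℤ := max 0 (k.choose (r + 1) - c * k)

theorem isConvexSeq_cliqueGain (c r : ℕ) : IsConvexSeq (cliqueGain c r) := fun k ↦ by
  let f : ℕ → ℤ := fun k ↦ k.choose (r + 1) - c * k
  have hf : IsConvexSeq f := fun k ↦ by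
    have hmono : (k.choose r : ℤ) ≤ (k + 1).choose r := by
      exact_mod_cast Nat.choose_le_choose r k.le_succ
    simp only [f, Nat.choose_succ_succ' (k + 1), Nat.choose_succ_succ' k]
    push_cast
    linarith
  have hpos : ∀ k, 0 ≤ cliqueGain c r k := fun k ↦ le_max_left _ _
  have hle : ∀ k, f k ≤ cliqueGain c r k := fun k ↦ le_max_right _ _
  obtain h | h : cliqueGain c r (k + 1) = 0 ∨ cliqueGain c r (k + 1) = f (k + 1) := max_choice _ _
  all_goals linarith [hf k, hpos k, hpos (k + 2), hle k, hle (k + 2)]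

theorem cliqueGain_mono (c r : ℕ) : Monotone (cliqueGain c r) := by
  refine monotone_nat_of_le_succ fun k ↦ ?_
  have h := (isConvexSeq_cliqueGain c r).add_le_add k.zero_le 1
  have h0 : cliqueGain c r 0 = 0 := by simp [cliqueGain]
  have h1 : 0 ≤ cliqueGain c r (0 + 1) := le_max_left _ _
  linarith

theorem cliqueGain_choose_one (q r : ℕ) : cliqueGain (q.choose r) r 1 = 0 := by
  obtain rfl | hr := r.eq_zero_or_pos
  · simp [cliqueGain]
  · simp [cliqueGain, Nat.choose_eq_zero_of_lt (show 1 < r + 1 by omega)]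

/-- The largest total gain, over vertices that each lie in `q.choose r` cliques of size `r + 1`, of
disjoint complete graphs of odd order at most `2 * q + 1` with `t` matching edges in total. -/
def gainBound (q r t : ℕ) : ℤ :=
  splitValue (fun j ↦ cliqueGain (q.choose r) r (2 * j + 1)) q t

theorem gainBound_nonneg (q r t : ℕ) : 0 ≤ gainBound q r t :=
  add_nonneg (mul_nonneg (Nat.cast_nonneg _) (le_max_left _ _)) (le_max_left _ _)

theorem gainBound_sub_add_le (hq : 0 < q) (r : ℕ) {t k : ℕ} (hk : k < 2 * (q + 1))
    (hkt : k / 2 ≤ t) :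
    gainBound q r (t - k / 2) + (k.choose (r + 1) - q.choose r * k) ≤ gainBound q r t := by
  have hsplit := splitValue_add_le (isConvexSeq_cliqueGain (q.choose r) r).comp_two_mul_add_one
    (cliqueGain_choose_one q r) hq (t - k / 2) (show k / 2 ≤ q by omega)
  rw [Nat.sub_add_cancel hkt] at hsplit
  calc gainBound q r (t - k / 2) + (k.choose (r + 1) - q.choose r * k)
    _ ≤ gainBound q r (t - k / 2) + cliqueGain (q.choose r) r k := by
      gcongr
      exact le_max_right _ _
    _ ≤ gainBound q r (t - k / 2) + cliqueGain (q.choose r) r (2 * (k / 2) + 1) := by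
      gcongr
      exact cliqueGain_mono _ _ (by omega)
    _ ≤ gainBound q r t := hsplit

theorem add_one_mul_choose_le_choose_two_mul (q i : ℕ) :
    (i + 1) * q.choose i ≤ (2 * q).choose i := by
  -- Each of the `i + 1` summands of the Vandermonde identity is at least `q.choose i`.
  rw [two_mul, Nat.add_choose_eq]
  calc (i + 1) * q.choose i = ∑ _x ∈ antidiagonal i, q.choose i := by simp
    _ ≤ ∑ x ∈ antidiagonal i, q.choose x.1 * q.choose x.2 := sum_le_sum fun x hx ↦ ?_
  rw [HasAntidiagonal.mem_antidiagonal] at hx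
  calc q.choose i
    _ ≤ q.choose i * i.choose x.1 := Nat.le_mul_of_pos_right _ (Nat.choose_pos (by omega))
    _ = q.choose x.1 * (q - x.1).choose x.2 := by
      rw [Nat.choose_mul (by omega), ← hx, Nat.add_sub_cancel_left]
    _ ≤ q.choose x.1 * q.choose x.2 :=
      Nat.mul_le_mul_left _ (Nat.choose_le_choose _ (Nat.sub_le _ _))

theorem choose_mul_two_mul_add_one_le (q r : ℕ) :
    q.choose r * (2 * q + 1) ≤ (2 * q + 1).choose (r + 1) := by
  refine Nat.le_of_mul_le_mul_right ?_ r.succ_pos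
  calc q.choose r * (2 * q + 1) * (r + 1)
    _ = (2 * q + 1) * ((r + 1) * q.choose r) := by ring
    _ ≤ (2 * q + 1) * (2 * q).choose r :=
      Nat.mul_le_mul_left _ (add_one_mul_choose_le_choose_two_mul q r)
    _ = (2 * q + 1).choose (r + 1) * (r + 1) := Nat.add_one_mul_choose_eq _ _

theorem gainBound_mul_add (r a : ℕ) {b : ℕ} (hb : b < q) :
    gainBound q r (a * q + b) =
      a * ((2 * q + 1).choose (r + 1) - q.choose r * (2 * q + 1)) +
        max (0 : ℤ) ((2 * b + 1).choose (r + 1) - q.choose r * (2 * b + 1)) := by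
  have hgain : (0 : ℤ) ≤ (2 * q + 1).choose (r + 1) - q.choose r * (2 * q + 1) :=
    sub_nonneg.2 (by exact_mod_cast choose_mul_two_mul_add_one_le q r)
  rw [gainBound, splitValue_mul_add _ a hb]
  simp [cliqueGain, max_eq_right hgain]

end Convexity

section BoundedMatchings

variable {V : Type*} {G : SimpleGraph V} {q t : ℕ}

theorem isContained_induce_of_subset {W : Type*} {H : SimpleGraph W} {A B : Set V} (hAB : A ⊆ B)
    (h : H ⊑ G.induce A) : H ⊑ G.induce B :=
  h.trans (induceHomOfLE G hAB).isContained

theorem M_free_induce_of_disjoint {A B : Set V} {j : ℕ} (hAB : Disjoint A B)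
    (hA : M j ⊑ G.induce A) (ht : (M (t + 1)).Free (G.induce (A ∪ B))) :
    j ≤ t ∧ (M (t - j + 1)).Free (G.induce B) := by
  have hle : j ≤ t := by
    by_contra! hlt
    exact ht ((M_isContained_M hlt).trans (isContained_induce_of_subset Set.subset_union_left hA))
  refine ⟨hle, fun hB ↦ ht ?_⟩
  have h := M_add_isContained_induce_union hAB hA hB
  rwa [show j + (t - j + 1) = t + 1 by omega] at h

theorem card_cliquesIn_le_of_P_free (hq : 0 < q) (r : ℕ) (hP : (P (2 * (q + 1))).Free G)
    (A : Finset V) (ht : (M (t + 1)).Free (G.induce A)) :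
    (#(cliquesIn G (r + 1) A) : ℤ) ≤ q.choose r * #A + gainBound q r t := by
  classical
  induction A using Finset.strongInduction generalizing t with
  | H A ih =>
  obtain rfl | hA := A.eq_empty_or_nonempty
  · have h := card_cliquesIn_le_choose G (r + 1) ∅
    rw [card_empty, Nat.choose_zero_succ, Nat.le_zero] at h
    simpa [h] using gainBound_nonneg q r t
  by_cases hdeg : ∀ v ∈ A, q + 1 ≤ #{w ∈ A | G.Adj v w}
  · obtain ⟨X, hXA, hX, hXlt, hPX, hiso⟩ := exists_isolated_path hA hdeg hP
    obtain ⟨hle, hfree⟩ : #X / 2 ≤ t ∧ (M (t - #X / 2 + 1)).Free (G.induce ↑(A \ X)) :=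
      M_free_induce_of_disjoint (mod_cast disjoint_sdiff)
        ((M_isContained_P (Nat.mul_div_le _ _)).trans hPX)
        (by rwa [← coe_union, union_sdiff_of_subset hXA])
    have hrest := ih (A \ X) (sdiff_ssubset hXA hX) hfree
    have hchoose := card_cliquesIn_le_choose G (r + 1) X
    have hgain := gainBound_sub_add_le hq r hXlt hle
    have hsum := card_cliquesIn_union r disjoint_sdiff hiso
    rw [union_sdiff_of_subset hXA] at hsum
    rw [← card_sdiff_add_card_eq_card hXA, hsum]
    zify at hchoose
    push_cast
    linarith
  · push Not at hdeg
    obtain ⟨v, hv, hvdeg⟩ := hdeg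
    have hrest := ih (A.erase v) (erase_ssubset hv)
      fun hM ↦ ht (isContained_induce_of_subset (mod_cast erase_subset v A) hM)
    have hdel := card_cliquesIn_le_of_degree_le (G := G) (r := r) (d := q) (erase_subset v A)
      (by simp [sdiff_erase_self hv, Nat.lt_succ_iff.1 hvdeg])
    rw [sdiff_erase_self hv, card_singleton, mul_one] at hdel
    rw [← card_erase_add_one hv]
    zify at hdel
    push_cast
    linarith

end BoundedMatchings

section CompleteBipartite

variable {V : Type*} {G : SimpleGraph V} {S Y : Finset V} {q s : ℕ}

theorem exists_perm_append_isChain {S Y : List V} (hlen : S.length = Y.length)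
    (hSY : ∀ x ∈ S, ∀ y ∈ Y, G.Adj x y) :
    ∃ l : List V, l.Perm (S ++ Y) ∧ l.head? = S.head? ∧ l.IsChain G.Adj := by
  induction S generalizing Y with
  | nil => exact ⟨[], by simpa [eq_comm] using hlen⟩
  | cons x S ih =>
    obtain ⟨y, Y, rfl⟩ := List.exists_cons_of_length_eq_add_one hlen.symm
    simp only [List.forall_mem_cons] at hSY
    obtain ⟨l, hperm, hhead, hl⟩ := ih (by simpa using hlen) fun z hz ↦ (hSY.2 z hz).2
    refine ⟨x :: y :: l, ((hperm.cons y).trans List.perm_middle.symm).cons x, rfl, ?_⟩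
    refine .cons_cons hSY.1.1 (List.isChain_cons.2 ⟨fun z hz ↦ ?_, hl⟩)
    exact (hSY.2 z (List.mem_of_mem_head? (hhead ▸ hz))).1.symm

theorem exists_isPathIn_union_of_isCompleteBetween [DecidableEq V]
    (hSY : G.IsCompleteBetween ↑S ↑Y) (hcard : #S ≤ #Y) {x : V} (hx : x ∈ S) :
    ∃ l, IsPathIn G (S ∪ Y) (x :: l) ∧ (x :: l).length = 2 * #S := by
  obtain ⟨Z, hZY, hZ⟩ := exists_subset_card_eq hcard
  have hS : (x :: (S.erase x).toList).Perm S.toList := by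
    simpa [insert_erase hx] using (toList_insert (notMem_erase x S)).symm
  have hmemS : ∀ z, z ∈ x :: (S.erase x).toList ↔ z ∈ S := fun z ↦ by rw [hS.mem_iff, mem_toList]
  obtain ⟨l, hperm, hhead, hl⟩ := exists_perm_append_isChain (G := G) (Y := Z.toList)
    (hS.length_eq.trans (by simp [hZ]))
    fun z hz y hy ↦ hSY ((hmemS z).1 hz) (hZY (mem_toList.1 hy))
  obtain ⟨l, rfl⟩ := List.head?_eq_some_iff.1 hhead
  refine ⟨l, ⟨hl, ?_, fun z hz ↦ ?_⟩, ?_⟩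
  · rw [hperm.nodup_iff, List.nodup_append', hS.nodup_iff]
    refine ⟨S.nodup_toList, Z.nodup_toList, fun z hzS hzZ ↦ ?_⟩
    exact Set.disjoint_left.1 hSY.disjoint ((hmemS z).1 hzS) (hZY (mem_toList.1 hzZ))
  · rw [hperm.mem_iff, List.mem_append, hmemS, mem_toList] at hz
    exact mem_union.2 (hz.imp_right (@hZY z))
  · rw [hperm.length_eq, List.length_append, hS.length_eq, length_toList, length_toList, hZ,
      two_mul]

theorem M_isContained_induce_union_of_isCompleteBetween [DecidableEq V]
    (hSY : G.IsCompleteBetween ↑S ↑Y) (hcard : #S ≤ #Y) : M #S ⊑ G.induce ↑(S ∪ Y) := by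
  obtain rfl | ⟨x, hx⟩ := S.eq_empty_or_nonempty
  · exact M_zero_isContained _
  obtain ⟨l, hl, hlen⟩ := exists_isPathIn_union_of_isCompleteBetween hSY hcard hx
  exact (M_isContained_P hlen.ge).trans <| (P_isContained_induce hl.isChain hl.nodup).trans <|
    isContained_induce_of_subset hl.mem .rfl

theorem mem_of_adj_of_adj_of_isCompleteBetween (hP : (P (2 * (#S + 1))).Free G)
    (hSY : G.IsCompleteBetween ↑S ↑Y) (hcard : #S + 2 ≤ #Y) {x v w : V} (hx : x ∈ S) (hv : v ∉ S)
    (hvx : G.Adj v x) (hvw : G.Adj v w) : w ∈ S := by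
  classical
  by_contra hw
  let Z := Y \ {v, w}
  have hZ : #S ≤ #Z := by
    have hsdiff : #Y - #{v, w} ≤ #Z := le_card_sdiff {v, w} Y
    have hpair : #{v, w} ≤ 2 := card_le_two
    omega
  obtain ⟨l, hl, hlen⟩ := exists_isPathIn_union_of_isCompleteBetween
    (G := G) (fun z hz y hy ↦ hSY hz (mem_sdiff.1 hy).1) hZ hx
  have hvl : v ∉ x :: l := fun h ↦ by simpa [Z, hv] using hl.mem v h
  have hwl : w ∉ v :: x :: l := by
    rw [List.mem_cons, not_or]
    exact ⟨hvw.ne', fun h ↦ by simpa [Z, hw] using hl.mem w h⟩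
  have hpath := P_isContained_induce ((hl.isChain.cons_cons hvx).cons_cons hvw.symm)
    ((hl.nodup.cons hvl).cons hwl)
  rw [List.length_cons, List.length_cons, hlen] at hpath
  exact hP (hpath.trans (Embedding.induce _).isContained)

theorem card_cliquesIn_le_of_isCompleteBetween [Fintype V] (hq : 0 < q) (r : ℕ)
    (hP : (P (2 * (q + 1))).Free G) (hM : (M (s + 1)).Free G) (hSY : G.IsCompleteBetween ↑S ↑Y)
    (hS : #S = q) (hY : q + 2 ≤ #Y) :
    (#(cliquesIn G (r + 1) univ) : ℤ) ≤
      q.choose r * (Fintype.card V - q) + q.choose (r + 1) + gainBound q r (s - q) := by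
  classical
  subst hS
  let R : Finset V := {v | v ∉ S ∧ ∀ x ∈ S, ¬G.Adj v x}
  have hSR : Disjoint S R := Finset.disjoint_right.2 fun v hv ↦ (mem_filter.1 hv).2.1
  have hSYR : Disjoint (S ∪ Y) R := by
    refine Finset.disjoint_union_left.2 ⟨hSR, Finset.disjoint_left.2 fun y hy hyR ↦ ?_⟩
    obtain ⟨x, hx⟩ := card_pos.1 hq
    exact (mem_filter.1 hyR).2.2 x hx (hSY hx hy).symm
  have hMR : #S ≤ s ∧ (M (s - #S + 1)).Free (G.induce R) := by
    refine M_free_induce_of_disjoint (mod_cast hSYR)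
      (M_isContained_induce_union_of_isCompleteBetween hSY (by omega)) fun h ↦ ?_
    exact hM (h.trans (Embedding.induce _).isContained)
  have hdeg : ∀ v ∈ univ \ (S ∪ R), #{w | G.Adj v w} ≤ #S := fun v hv ↦ by
    obtain ⟨hvS, hnbr⟩ : v ∉ S ∧ (v ∉ S → ∃ x ∈ S, G.Adj v x) := by simpa [R] using hv
    obtain ⟨x, hx, hvx⟩ := hnbr hvS
    exact card_le_card fun w hw ↦
      mem_of_adj_of_adj_of_isCompleteBetween hP hSY hY hx hvS hvx (mem_filter.1 hw).2
  have hsum := card_cliquesIn_union (G := G) r hSR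
    fun x hx v hv h ↦ (mem_filter.1 hv).2.2 x hx h.symm
  have hrest := card_cliquesIn_le_of_degree_le (r := r) (subset_univ (S ∪ R)) hdeg
  have hcore := card_cliquesIn_le_choose G (r + 1) S
  have hR := card_cliquesIn_le_of_P_free hq r hP R hMR.2
  have hcard : #S + #R + #(univ \ (S ∪ R)) = Fintype.card V := by
    rw [← card_union_of_disjoint hSR, add_comm, card_sdiff_add_card_eq_card (subset_univ _),
      card_univ]
  rw [← hcard]
  zify at hsum hrest hcore
  push_cast
  linarith

end CompleteBipartite

section Dichotomy

variable {V : Type*} {G : SimpleGraph V} {q r s m : ℕ}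

theorem exists_isCompleteBetween_of_lt_card [DecidableRel G.Adj] {U Y : Finset V}
    (hdeg : ∀ y ∈ Y, q ≤ #{u ∈ U | G.Adj y u}) (hY : 2 ^ #U * m < #Y) :
    ∃ S Z : Finset V, #S = q ∧ m < #Z ∧ G.IsCompleteBetween ↑S ↑Z := by
  classical
  have hchoice : ∀ y, ∃ S : Finset V, y ∈ Y → S ⊆ ({u ∈ U | G.Adj y u} : Finset V) ∧ #S = q :=
    fun y ↦ by
      by_cases hy : y ∈ Y
      · obtain ⟨S, hS⟩ := exists_subset_card_eq (hdeg y hy)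
        exact ⟨S, fun _ ↦ hS⟩
      · exact ⟨∅, fun h ↦ absurd h hy⟩
  choose nbrs hnbrs using hchoice
  have hmaps : ∀ y ∈ Y, nbrs y ∈ U.powerset := fun y hy ↦
    mem_powerset.2 ((hnbrs y hy).1.trans (filter_subset _ _))
  obtain ⟨S, -, hS⟩ := exists_lt_card_fiber_of_mul_lt_card_of_maps_to hmaps
    (by rwa [card_powerset])
  obtain ⟨y, hy⟩ := card_pos.1 (m.zero_le.trans_lt hS)
  obtain ⟨hyY, rfl⟩ := mem_filter.1 hy
  refine ⟨nbrs y, _, (hnbrs y hyY).2, hS, fun x hx z hz ↦ ?_⟩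
  obtain ⟨hzY, hzy⟩ := mem_filter.1 hz
  exact (mem_filter.1 ((hnbrs z hzY).1 (hzy ▸ hx))).2.symm

theorem choose_pred_add_one_le (hr : 0 < r) (hrq : r ≤ q) : (q - 1).choose r + 1 ≤ q.choose r := by
  obtain ⟨i, rfl⟩ := Nat.exists_eq_add_one.2 hr
  obtain ⟨d, rfl⟩ := Nat.exists_eq_add_one.2 (hr.trans_le hrq)
  rw [Nat.choose_succ_succ', Nat.add_sub_cancel, add_comm]
  exact Nat.add_le_add_right (Nat.choose_pos (by omega)) _

variable [Fintype V]

theorem card_cliquesIn_le_two_pow_add [DecidableRel G.Adj] {d : ℕ} (r : ℕ) (B : Finset V)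
    (hdeg : ∀ v ∉ B, G.degree v ≤ d) :
    #(cliquesIn G (r + 1) univ) ≤ 2 ^ #B + d.choose r * Fintype.card V := by
  classical
  calc #(cliquesIn G (r + 1) univ)
    _ ≤ #(cliquesIn G (r + 1) B) + d.choose r * #(univ \ B) := by
      refine card_cliquesIn_le_of_degree_le (subset_univ B) fun v hv ↦ ?_
      rw [← neighborFinset_eq_filter]
      exact hdeg v (mem_sdiff.1 hv).2
    _ ≤ 2 ^ #B + d.choose r * Fintype.card V := by
      gcongr
      · exact (card_cliquesIn_le_choose G (r + 1) B).trans (Nat.choose_le_two_pow _ _)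
      · exact card_le_univ _

theorem exists_isCompleteBetween_or_card_cliquesIn_le (hr : 0 < r) (hrq : r ≤ q)
    (hM : (M (s + 1)).Free G)
    (hV : 2 ^ (2 * s + 2 ^ (2 * s) * m) + q.choose r * q ≤ Fintype.card V) :
    (∃ S Y : Finset V, #S = q ∧ m < #Y ∧ G.IsCompleteBetween ↑S ↑Y) ∨
      (#(cliquesIn G (r + 1) univ) : ℤ) ≤ q.choose r * (Fintype.card V - q) := by
  classical
  obtain ⟨U, hUcard, hU⟩ := exists_isVertexCover_of_M_free hM
  have hpow : 2 ^ #U * m ≤ 2 ^ (2 * s) * m := by gcongr; norm_num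
  let Y : Finset V := {y | y ∉ U ∧ q ≤ G.degree y}
  obtain hY | hY := lt_or_ge (2 ^ #U * m) #Y
  · refine .inl (exists_isCompleteBetween_of_lt_card (U := U) (fun y hy ↦ ?_) hY)
    obtain ⟨hyU, hdeg⟩ := (mem_filter.1 hy).2
    refine hdeg.trans (card_le_card fun w hw ↦ ?_)
    have hyw : G.Adj y w := (mem_neighborFinset ..).1 hw
    exact mem_filter.2 ⟨(hU hyw).resolve_left hyU, hyw⟩
  · right
    have hcount := card_cliquesIn_le_two_pow_add (G := G) (d := q - 1) r (U ∪ Y) fun v hv ↦ by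
      simp only [Y, mem_union, mem_filter, mem_univ, true_and, not_or, not_and, not_le] at hv
      exact Nat.le_sub_one_of_lt (hv.2 hv.1)
    have hB : 2 ^ #(U ∪ Y) ≤ 2 ^ (2 * s + 2 ^ (2 * s) * m) :=
      Nat.pow_le_pow_right two_pos ((card_union_le _ _).trans (by omega))
    have hchoose := Nat.mul_le_mul_right (Fintype.card V) (choose_pred_add_one_le hr hrq)
    zify at hcount hB hchoose hV
    rw [mul_sub]
    linarith

end Dichotomy

section Freeness

variable {V W X : Type} {G : SimpleGraph V} {H : SimpleGraph W} {F : SimpleGraph X}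
  {k m n q r a b s t : ℕ}

theorem isContained_of_forall_isLeft (f : Copy F (G ⊕g H)) (hf : ∀ x, (f x).isLeft) : F ⊑ G := by
  have hinl : ∀ x, ∃ v, f x = .inl v := fun x ↦ Sum.isLeft_iff.1 (hf x)
  choose g hg using hinl
  refine ⟨⟨⟨g, fun {x y} hxy ↦ ?_⟩, fun x y hxy ↦ ?_⟩⟩
  · have hadj := f.toHom.map_adj hxy
    rwa [Copy.coe_toHom, hg, hg, sum_adj_inl] at hadj
  · exact f.injective ((hg x).trans ((congrArg Sum.inl hxy).trans (hg y).symm))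

theorem free_sum_of_connected (hF : F.Connected) (hG : F.Free G) (hH : F.Free H) :
    F.Free (G ⊕g H) := by
  rintro ⟨f⟩
  obtain ⟨x⟩ := hF.nonempty
  have hreach : ∀ y, (G ⊕g H).Reachable (f x) (f y) := fun y ↦ (hF.preconnected x y).map f.toHom
  obtain ⟨v, hv⟩ | ⟨w, hw⟩ : (∃ v, f x = .inl v) ∨ ∃ w, f x = .inr w := by
    cases f x <;> simp
  · refine hG (isContained_of_forall_isLeft f fun y ↦ ?_)
    by_contra hy
    obtain ⟨w, hw⟩ := Sum.isRight_iff.1 (Sum.not_isLeft.1 hy)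
    exact not_reachable_sum_inl_inr v w (hv ▸ hw ▸ hreach y)
  · refine hH (isContained_of_forall_isLeft (Iso.sumComm.toCopy.comp f) fun y ↦ ?_)
    by_contra hy
    obtain ⟨v, hv⟩ : ∃ v, f y = .inl v := Sum.isLeft_iff.1 (by simpa [Iso.sumComm] using hy)
    exact not_reachable_sum_inl_inr v w (hv ▸ hw ▸ (hreach y).symm)

theorem free_copies_of_connected (hF : F.Connected) (hG : F.Free G) (k : ℕ) :
    F.Free (copies k G) := by
  induction k with
  | zero =>
    rintro ⟨f⟩
    obtain ⟨x⟩ := hF.nonempty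
    exact (f x).1.elim0
  | succ k ih => exact (free_congr_right (copiesSuccIso k G)).1 (free_sum_of_connected hF ih hG)

theorem M_isContained_left (f : Copy (M k) (G ⊕g H)) : M #{i | (f (i, 0)).isLeft} ⊑ G := by
  let I : Finset (Fin k) := {i | (f (i, 0)).isLeft}
  let e : Fin #I ↪o Fin k := I.orderEmbOfFin rfl
  let g : Copy (M #I) (M k) :=
    ⟨⟨Prod.map e id, fun h ↦ ⟨congrArg e h.1, h.2⟩⟩, e.injective.prodMap Function.injective_id⟩
  refine isContained_of_forall_isLeft (f.comp g) fun (i, j) ↦ ?_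
  have hi : (f (e i, 0)).isLeft := (mem_filter.1 (I.orderEmbOfFin_mem rfl i)).2
  fin_cases j
  · exact hi
  · have hadj := f.toHom.map_adj (v := (e i, 0)) (w := (e i, 1)) ⟨rfl, Fin.zero_ne_one⟩
    obtain ⟨v, hv⟩ := Sum.isLeft_iff.1 hi
    by_contra h
    obtain ⟨w, hw⟩ := Sum.isRight_iff.1 (Sum.not_isLeft.1 h)
    exact not_adj_sum_inl_inr v w (hv ▸ hw ▸ hadj)

theorem M_free_sum (hG : (M (s + 1)).Free G) (hH : (M (t + 1)).Free H) :
    (M (s + t + 1)).Free (G ⊕g H) := by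
  rintro ⟨f⟩
  have hleft := M_isContained_left f
  have hright : M #{i | ¬(f (i, 0)).isLeft} ⊑ H := by
    have hswap : ({i | ¬(f (i, 0)).isLeft} : Finset (Fin (s + t + 1))) =
        ({i | ((Iso.sumComm.toCopy.comp f) (i, 0)).isLeft} : Finset (Fin (s + t + 1))) := by
      ext i
      simp only [Sum.not_isLeft, mem_filter_univ, ← Sum.isLeft_swap]
      rfl
    exact hswap ▸ M_isContained_left (Iso.sumComm.toCopy.comp f)
  have hcard : #{i | (f (i, 0)).isLeft} + #{i | ¬(f (i, 0)).isLeft} = s + t + 1 := by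
    rw [card_filter_add_card_filter_not, card_fin]
  obtain hlt | hlt : s + 1 ≤ #{i | (f (i, 0)).isLeft} ∨ t + 1 ≤ #{i | ¬(f (i, 0)).isLeft} := by
    omega
  · exact hG ((M_isContained_M hlt).trans hleft)
  · exact hH ((M_isContained_M hlt).trans hright)

theorem M_free_copies (hG : (M (t + 1)).Free G) (k : ℕ) : (M (k * t + 1)).Free (copies k G) := by
  induction k with
  | zero =>
    rintro ⟨f⟩
    exact (f (Fin.last _, 0)).1.elim0
  | succ k ih =>
    rw [Nat.succ_mul]
    exact (free_congr_right (copiesSuccIso k G)).1 (M_free_sum ih hG)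

theorem M_free_K (k : ℕ) : (M (k + 1)).Free (K (2 * k + 1)) := fun h ↦ by
  have := two_mul_le_of_M_isContained_K h
  omega

theorem M_free_join_I (q m : ℕ) : (M (q + 1)).Free (join (K q) (I m)) := fun h ↦ by
  have hcover : (join (K q) (I m)).IsVertexCover ↑(univ.map (joinInl (K q) (I m)).toEmbedding) := by
    rintro (v | v) (w | w) hvw
    all_goals simp_all [join, joinInl]
  have := le_card_of_M_isContained_of_isVertexCover hcover h
  simp at this

theorem P_free_of_M_free (h : (M k).Free G) : (P (2 * k)).Free G := fun hP ↦
  h ((M_isContained_P le_rfl).trans hP)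

theorem connected_P (hk : 0 < k) : (P k).Connected := by
  obtain ⟨k, rfl⟩ := Nat.exists_eq_add_one.2 hk
  exact pathGraph_connected k

theorem M_free_G₁ (n q a : ℕ) : (M (q + a * q + 1)).Free (G₁ n (q + 1) a) :=
  M_free_sum (M_free_join_I q _) (M_free_copies (M_free_K q) a)

theorem M_free_G₂ (n q a b : ℕ) : (M (q + (a * q + b) + 1)).Free (G₂ n (q + 1) a b) := by
  rw [← add_assoc]
  exact M_free_sum (M_free_sum (M_free_join_I q _) (M_free_copies (M_free_K q) a)) (M_free_K b)

theorem P_free_G₁ (n q a : ℕ) : (P (2 * (q + 1))).Free (G₁ n (q + 1) a) :=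
  free_sum_of_connected (connected_P (by omega)) (P_free_of_M_free (M_free_join_I q _))
    (free_copies_of_connected (connected_P (by omega)) (P_free_of_M_free (M_free_K q)) a)

theorem P_free_G₂ (n a : ℕ) (hb : b ≤ q) : (P (2 * (q + 1))).Free (G₂ n (q + 1) a b) :=
  free_sum_of_connected (connected_P (by omega))
    (free_sum_of_connected (connected_P (by omega)) (P_free_of_M_free (M_free_join_I q _))
      (free_copies_of_connected (connected_P (by omega)) (P_free_of_M_free (M_free_K q)) a))
    (P_free_of_M_free fun h ↦ M_free_K b ((M_isContained_M (by omega)).trans h))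

end Freeness

section ExtremalNumber

variable {V : Type} {G : SimpleGraph V} {k l n q r s : ℕ}

theorem familyFree_pair :
    FamilyFree {⟨Fin k, P k⟩, ⟨Fin l × Fin 2, M l⟩} G ↔ (P k).Free G ∧ (M l).Free G := by
  simp [FamilyFree]

variable [Fintype V]

theorem N_K_le_ex {𝓕 : Set (Σ W : Type, SimpleGraph W)} (hn : Fintype.card V = n) (r : ℕ)
    (hG : FamilyFree 𝓕 G) : N (K r) G ≤ ex n (K r) 𝓕 := by
  classical
  let e : G ≃g G.map (Fintype.equivFinOfCardEq hn).toEmbedding :=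
    Iso.map (Fintype.equivFinOfCardEq hn) G
  rw [N_K_congr e r]
  exact le_sup (f := fun G ↦ N (K r) G)
    (mem_filter.2 ⟨mem_univ _, fun F hF ↦ (free_congr_right e).1 (hG F hF)⟩)

theorem N_K_eq_zero_of_P_free (hG : (P k).Free G) (hkr : k ≤ r) : N (K r) G = 0 := by
  rw [N, copyCount_eq_zero]
  exact fun h ↦ hG (IsContained.trans ⟨⟨⟨Fin.castLE hkr, fun hxy hne ↦
    hxy.ne (Fin.castLE_injective hkr hne)⟩, Fin.castLE_injective hkr⟩⟩ h)

theorem N_K_le_of_free (hq : 0 < q) (hrq : r ≤ q) (hP : (P (2 * (q + 1))).Free G)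
    (hM : (M (s + 1)).Free G)
    (hV : 2 ^ (2 * s + 2 ^ (2 * s) * (q + 1)) + q.choose r * q ≤ Fintype.card V) :
    (N (K (r + 1)) G : ℤ) ≤
      q.choose r * (Fintype.card V - q) + q.choose (r + 1) + gainBound q r (s - q) := by
  classical
  rw [N_K_eq]
  have hgain := gainBound_nonneg q r (s - q)
  obtain rfl | hr := Nat.eq_zero_or_pos r
  · rw [zero_add, card_cliquesIn_one, card_univ, Nat.choose_zero_right, Nat.choose_one_right]
    push_cast
    linarith
  · obtain ⟨S, Y, hS, hY, hSY⟩ | hfew := exists_isCompleteBetween_or_card_cliquesIn_le hr hrq hM hV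
    · exact card_cliquesIn_le_of_isCompleteBetween hq r hP hM hSY hS hY
    · have := Int.natCast_nonneg (q.choose (r + 1))
      linarith

theorem N_K_le_max_of_free {a b : ℕ} (hb : b < q) (hrq : r ≤ q)
    (hP : (P (2 * (q + 1))).Free G) (hM : (M (q + (a * q + b) + 1)).Free G)
    (hV : Fintype.card V = n)
    (hn : 2 ^ (2 * (q + (a * q + b)) + 2 ^ (2 * (q + (a * q + b))) * (q + 1)) +
      q.choose r * q ≤ n)
    (hn' : q + a * (2 * q + 1) + (2 * b + 1) ≤ n) :
    N (K (r + 1)) G ≤ max (N (K (r + 1)) (G₁ n (q + 1) a)) (N (K (r + 1)) (G₂ n (q + 1) a b)) := by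
  have hle := N_K_le_of_free (by omega) hrq hP hM (hn.trans_eq hV.symm)
  obtain ⟨m, rfl⟩ := Nat.exists_eq_add_of_le hn'
  rw [Nat.add_sub_cancel_left, gainBound_mul_add r a hb, hV] at hle
  have hI : q + a * (2 * q + 1) + (2 * b + 1) + m - q - a * (2 * q + 1) = 2 * b + 1 + m := by
    omega
  rw [N_K_G₁, N_K_G₂, hI, Nat.add_sub_cancel_left, le_max_iff]
  zify
  push_cast at hle ⊢
  obtain ⟨hmax, -⟩ | ⟨hmax, -⟩ := max_cases (0 : ℤ)
    ((2 * b + 1).choose (r + 1) - q.choose r * (2 * b + 1))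
  all_goals rw [hmax] at hle
  · left; linarith
  · right; linarith

end ExtremalNumber

section LowerBound

variable {n q a b : ℕ}

theorem N_K_G₁_le_ex (r : ℕ) (hn : q + a * (2 * q + 1) ≤ n) (b : ℕ) :
    N (K r) (G₁ n (q + 1) a) ≤ ex n (K r) {⟨Fin (2 * (q + 1)), P (2 * (q + 1))⟩,
      ⟨Fin (q + (a * q + b) + 1) × Fin 2, M (q + (a * q + b) + 1)⟩} := by
  refine N_K_le_ex ?_ r (familyFree_pair.2 ⟨P_free_G₁ n q a, fun h ↦
    M_free_G₁ n q a ((M_isContained_M (by omega)).trans h)⟩)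
  have : 2 * (q + 1) - 1 = 2 * q + 1 := rfl
  simp only [Fintype.card_sum, Fintype.card_prod, Fintype.card_fin, this]
  omega

theorem N_K_G₂_le_ex (r : ℕ) (hb : b ≤ q) (hn : q + a * (2 * q + 1) + (2 * b + 1) ≤ n) :
    N (K r) (G₂ n (q + 1) a b) ≤ ex n (K r) {⟨Fin (2 * (q + 1)), P (2 * (q + 1))⟩,
      ⟨Fin (q + (a * q + b) + 1) × Fin 2, M (q + (a * q + b) + 1)⟩} := by
  refine N_K_le_ex ?_ r (familyFree_pair.2 ⟨P_free_G₂ n a hb, M_free_G₂ n q a b⟩)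
  have : 2 * (q + 1) - 1 = 2 * q + 1 := rfl
  simp only [Fintype.card_sum, Fintype.card_prod, Fintype.card_fin, this]
  omega

end LowerBound

end GenTuran

theorem theorem1p7 (r p s a b : ℕ) (hr1 : 1 ≤ r) (hr : r ≤ p ∨ 2 * p ≤ r)
    (hab : (s : ℤ) - p + 1 = a * ((p : ℤ) - 1) + b) (hb : (b : ℤ) ≤ (p : ℤ) - 2) :
    ∃ n₀ : ℕ, ∀ n : ℕ, n₀ ≤ n →
      GenTuran.ex n (GenTuran.K r)
          {⟨Fin (2 * p), GenTuran.P (2 * p)⟩, ⟨Fin (s + 1) × Fin 2, GenTuran.M (s + 1)⟩} =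
        max (GenTuran.N (GenTuran.K r) (GenTuran.G₁ n p a))
          (GenTuran.N (GenTuran.K r) (GenTuran.G₂ n p a b)) := by
  classical
  obtain ⟨r, rfl⟩ := Nat.exists_eq_add_of_le' hr1
  obtain ⟨q, rfl⟩ : ∃ q, p = q + 1 := Nat.exists_eq_add_of_le' (by omega)
  obtain rfl : s = q + (a * q + b) := by push_cast at hab; zify; linarith
  refine ⟨max (2 ^ (2 * (q + (a * q + b)) + 2 ^ (2 * (q + (a * q + b))) * (q + 1)) +
    q.choose r * q) (q + a * (2 * q + 1) + (2 * b + 1)), fun n hn ↦ ?_⟩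
  obtain ⟨hn₁, hn₂⟩ := max_le_iff.1 hn
  refine le_antisymm (Finset.sup_le fun G hG ↦ ?_) (max_le
    (GenTuran.N_K_G₁_le_ex _ (by omega) b) (GenTuran.N_K_G₂_le_ex _ (by omega) hn₂))
  obtain ⟨hP, hM⟩ := GenTuran.familyFree_pair.1 (Finset.mem_filter.1 hG).2
  obtain hr | hr := hr
  · exact GenTuran.N_K_le_max_of_free (by omega) (Nat.le_of_succ_le_succ hr) hP hM
      (Fintype.card_fin n) hn₁ hn₂
  · exact (GenTuran.N_K_eq_zero_of_P_free hP hr).trans_le (Nat.zero_le _)
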